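/- Let $p$ be a prime, let $m \ge 2$, let $C_p$ be the cyclic group of order $p$ with generator $x$, and let $F_m$ be the free group on $m$ generators. Let $\zeta_{p^2}$ be a primitive $p^2$-th root of unity, so that $\mathbf{Z}[\zeta_{p^2}] \cong \mathbf{Z}[X]/(c_{p^2}(X))$ with $c_{p^2}$ the $p^2$-th cyclotomic polynomial. Let $\psi_- : \mathbf{Z}[\zeta_{p^2}][F_m] \to \mathbf{F}_p[C_p\times F_m]$ be the ring homomorphism with $\zeta_{p^2} \mapsto x$ and $g \mapsto g$ for $g \in F_m$, and let $\psi_+ : \mathbf{Z}[C_p\times F_m] \to \mathbf{F}_p[C_p\times F_m]$ be reduction of coefficients modulo $p$. Write $R^*$ for the unit group of a ring $R$ and $[R^*,R^*]$ for the commutator subgroup of $R^*$. Let $$X=\psi_-(\mathbf{Z}[\zeta_{p^2}][F_m]^*)\backslash[\mathbf{F}_p[C_p\times F_m]^*,\mathbf{F}_p[C_p\times F_m]^*]/\psi_+(\mathbf{Z}[C_p\times F_m]^*)$$ be the set of those double cosets $\psi_-(\mathbf{Z}[\zeta_{p^2}][F_m]^*)\, a\, \psi_+(\mathbf{Z}[C_p\times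 F_m]^*)$ in $\mathbf{F}_p[C_p\times F_m]^*$ that are represented by an element $a$ of the commutator subgroup. Then $X$ is infinite. More precisely, let $y = 1-x$, so that $y^p=0$ and $1+yt$ is a unit of $\mathbf{F}_p[C_p\times F_m]$ for every $t\in F_m$. For any two distinct free generators $s,t$ among the given generators of $F_m$, the elements $$\delta_n = (1+yt)s^n(1+yt)^{-1}s^{-n}, \qquad n \in \mathbf{N}=\{0,1,2,\dots\},$$ lie in $[\mathbf{F}_p[C_p\times F_m]^*,\mathbf{F}_p[C_p\times F_m]^*]$ and represent pairwise distinct elements of $X$. -/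

import Mathlib

noncomputable section

namespace UnitCosets

/-- The cyclic group `C_p` of order `p`, written multiplicatively. -/
abbrev Cyc (p : ℕ) : Type := Multiplicative (ZMod p)

/-- The free group `F_m` on `m` generators. -/
abbrev Free (m : ℕ) : Type := FreeGroup (Fin m)

/-- The group ring `𝔽_p[C_p × F_m]`. -/
abbrev RingZero (p m : ℕ) : Type := MonoidAlgebra (ZMod p) (Cyc p × Free m)

/-- The group ring `ℤ[C_p × F_m]`. -/
abbrev RingPlus (p m : ℕ) : Type := MonoidAlgebra ℤ (Cyc p × Free m)

/-- The ring `ℤ[ζ]`, `ζ` a primitive `p²`-th root of unity, as `ℤ[X]` modulo the `p²`-th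
cyclotomic polynomial; `ζ` is the class of `X`. -/
abbrev ZZeta (p : ℕ) : Type := AdjoinRoot (Polynomial.cyclotomic (p ^ 2) ℤ)

/-- The group ring `ℤ[ζ][F_m]`. -/
abbrev RingMinus (p m : ℕ) : Type := MonoidAlgebra (ZZeta p) (Free m)

theorem cyc_pow (p : ℕ) (x : Cyc p) : x ^ p = 1 := by
  rw [← ofAdd_toAdd x, ← ofAdd_nsmul]
  simp

/-- `x ∈ C_p` is a root in `𝔽_p[C_p]` of the `p²`-th cyclotomic polynomial. -/
theorem eval₂_cyclotomic (p : ℕ) [hp : Fact p.Prime] (x : Cyc p) :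
    (Polynomial.cyclotomic (p ^ 2) ℤ).eval₂ (Int.castRingHom (MonoidAlgebra (ZMod p) (Cyc p)))
      (MonoidAlgebra.of (ZMod p) (Cyc p) x) = 0 := by
  have h : (p : MonoidAlgebra (ZMod p) (Cyc p)) = 0 := by
    rw [← map_natCast (algebraMap (ZMod p) (MonoidAlgebra (ZMod p) (Cyc p))) p]
    simp
  rw [show p ^ 2 = p ^ (1 + 1) from rfl, Polynomial.cyclotomic_prime_pow_eq_geom_sum hp.out,
    Polynomial.eval₂_finsetSum]
  simp only [Polynomial.eval₂_pow, Polynomial.eval₂_X, pow_one, ← map_pow, cyc_pow, one_pow,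
    map_one, Finset.sum_const, Finset.card_range, nsmul_eq_mul, mul_one, h]

/-- The ring homomorphism `ℤ[ζ] → 𝔽_p[C_p]` with `ζ ↦ x`. -/
def zetaHom (p : ℕ) [Fact p.Prime] (x : Cyc p) : ZZeta p →+* MonoidAlgebra (ZMod p) (Cyc p) :=
  AdjoinRoot.lift (Int.castRingHom (MonoidAlgebra (ZMod p) (Cyc p)))
    (MonoidAlgebra.of (ZMod p) (Cyc p) x) (eval₂_cyclotomic p x)

/-- The inclusion `𝔽_p[C_p] → 𝔽_p[C_p × F_m]`. -/
def inclCyc (p m : ℕ) : MonoidAlgebra (ZMod p) (Cyc p) →+* RingZero p m :=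
  MonoidAlgebra.mapDomainRingHom (ZMod p) (MonoidHom.inl (Cyc p) (Free m))

/-- The inclusion of `F_m` in `𝔽_p[C_p × F_m]`. -/
def inclFree (p m : ℕ) : Free m →* RingZero p m :=
  (MonoidAlgebra.of (ZMod p) (Cyc p × Free m)).comp (MonoidHom.inr (Cyc p) (Free m))

theorem commute_incl (p m : ℕ) (a : MonoidAlgebra (ZMod p) (Cyc p)) (g : Free m) :
    Commute (inclCyc p m a) (inclFree p m g) := by
  induction a using MonoidAlgebra.induction_linear with
  | zero => simp
  | add a b ha hb => rw [map_add]; exact ha.add_left hb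
  | single c r =>
    simp [inclCyc, inclFree, Commute, SemiconjBy, MonoidAlgebra.single_mul_single]

/-- The ring homomorphism `ψ₋ : ℤ[ζ][F_m] → 𝔽_p[C_p × F_m]` with `ζ ↦ x` and `g ↦ g` for
`g ∈ F_m`. -/
def psiMinus (p m : ℕ) [Fact p.Prime] (x : Cyc p) : RingMinus p m →+* RingZero p m :=
  MonoidAlgebra.liftNCRingHom ((inclCyc p m).comp (zetaHom p x)) (inclFree p m)
    fun _ _ => commute_incl p m _ _

/-- The ring homomorphism `ψ₊ : ℤ[C_p × F_m] → 𝔽_p[C_p × F_m]`, reduction of the coefficients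
modulo `p`. -/
def psiPlus (p m : ℕ) : RingPlus p m →+* RingZero p m :=
  MonoidAlgebra.mapRingHom (Cyc p × Free m) (Int.castRingHom (ZMod p))

/-- The subgroup `ψ₋(ℤ[ζ][F_m]^*)` of `𝔽_p[C_p × F_m]^*`. -/
def unitsMinus (p m : ℕ) [Fact p.Prime] (x : Cyc p) : Subgroup (RingZero p m)ˣ :=
  (Units.map (psiMinus p m x : RingMinus p m →* RingZero p m)).range

/-- The subgroup `ψ₊(ℤ[C_p × F_m]^*)` of `𝔽_p[C_p × F_m]^*`. -/
def unitsPlus (p m : ℕ) : Subgroup (RingZero p m)ˣ :=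
  (Units.map (psiPlus p m : RingPlus p m →* RingZero p m)).range

/-- The class of `a` in the double coset space
`ψ₋(ℤ[ζ][F_m]^*) \ 𝔽_p[C_p × F_m]^* / ψ₊(ℤ[C_p × F_m]^*)`. -/
def cosetClass (p m : ℕ) [Fact p.Prime] (x : Cyc p) (a : (RingZero p m)ˣ) :
    DoubleCoset.Quotient (unitsMinus p m x : Set (RingZero p m)ˣ) (unitsPlus p m) :=
  DoubleCoset.mk (unitsMinus p m x) (unitsPlus p m) a

/-- `ψ₋(ℤ[ζ][F_m]^*) \ [𝔽_p[C_p × F_m]^*, 𝔽_p[C_p × F_m]^*] / ψ₊(ℤ[C_p × F_m]^*)`: the set of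
double cosets that are represented by elements of the commutator subgroup. (The two subgroups
need not lie in the commutator subgroup.) -/
def commutatorCosets (p m : ℕ) [Fact p.Prime] (x : Cyc p) :
    Set (DoubleCoset.Quotient (unitsMinus p m x : Set (RingZero p m)ˣ) (unitsPlus p m)) :=
  cosetClass p m x '' (commutator (RingZero p m)ˣ : Set (RingZero p m)ˣ)

/-- The element `y = 1 - x` of `𝔽_p[C_p]`. -/
def yElem (p : ℕ) (x : Cyc p) : MonoidAlgebra (ZMod p) (Cyc p) :=
  1 - MonoidAlgebra.of (ZMod p) (Cyc p) x

theorem yElem_pow (p : ℕ) [hp : Fact p.Prime] (x : Cyc p) : yElem p x ^ p = 0 := by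
  have : CharP (MonoidAlgebra (ZMod p) (Cyc p)) p :=
    charP_of_injective_algebraMap
      (algebraMap (ZMod p) (MonoidAlgebra (ZMod p) (Cyc p))).injective p
  rw [yElem, sub_pow_char, ← map_pow, cyc_pow, map_one, one_pow, sub_self]

theorem isUnit_one_add_yt (p m : ℕ) [Fact p.Prime] (x : Cyc p) (t : Free m) :
    IsUnit (1 + inclCyc p m (yElem p x) * inclFree p m t) := by
  refine IsNilpotent.isUnit_one_add ?_
  refine (commute_incl p m _ t).isNilpotent_mul_right ⟨p, ?_⟩
  rw [← map_pow, yElem_pow, map_zero]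

/-- The unit `1 + y t` of `𝔽_p[C_p × F_m]`, where `y = 1 - x`. -/
def oneAddYT (p m : ℕ) [Fact p.Prime] (x : Cyc p) (t : Free m) : (RingZero p m)ˣ :=
  (isUnit_one_add_yt p m x t).unit

/-- An element of `F_m` as a unit of `𝔽_p[C_p × F_m]`. -/
def freeUnit (p m : ℕ) : Free m →* (RingZero p m)ˣ :=
  (inclFree p m).toHomUnits

/-- `δ_n = (1 + y t) s^n (1 + y t)⁻¹ s⁻ⁿ`, where `y = 1 - x`. -/
def delta (p m : ℕ) [Fact p.Prime] (x : Cyc p) (s t : Free m) (n : ℕ) : (RingZero p m)ˣ :=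
  oneAddYT p m x t * freeUnit p m s ^ n * (oneAddYT p m x t)⁻¹ * (freeUnit p m s ^ n)⁻¹

end UnitCosets

end

/-! Modulo `y²` the ring `𝔽_p[C_p]` becomes `𝔽_p[ε]`, with `y` sent to a nonzero multiple `αε`. In
`𝔽_p[ε][F_m]` the images of both unit groups consist of monomials `r g`. For `ℤ[ζ][F_m]` this holds
because the coefficients form a domain and free groups have unique products. For `ℤ[C_p × F_m]` one
uses the two domains `ℤ` and `ℤ[ζ_p]` into whose product `ℤ[C_p]` embeds; the two monomials so
obtained sit at the same group element because the projections are congruent over `p`. The image of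
`δ_n` is `1 + αε(t - sⁿ t s⁻ⁿ)`. Monomial factors can only conjugate the pair `t`, `sⁿ t s⁻ⁿ` and
perhaps swap it, so the double coset determines the conjugacy class of `t sⁿ t s⁻ⁿ`, hence the trace
`2 - n²` of its image in `SL₂(ℤ)`. -/

/-! ### Unique products in free groups -/

/-- A free group with a nontrivial element has a homomorphism to `ℤ` that is nontrivial on any
given generating set. -/
theorem IsFreeGroup.exists_hom_int_ne_one {G : Type*} [Group G] [IsFreeGroup G] {S : Set G}
    (hS : Subgroup.closure S = ⊤) {g : G} (hg : g ≠ 1) :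
    ∃ φ : G →* Multiplicative ℤ, ∃ s ∈ S, φ s ≠ 1 := by
  have hne : Nonempty (IsFreeGroup.Generators G) := by
    by_contra h
    rw [not_nonempty_iff] at h
    have h1 : MonoidHom.id G = 1 := IsFreeGroup.ext_hom fun a => h.elim a
    exact hg (DFunLike.congr_fun h1 g)
  obtain ⟨a⟩ := hne
  refine ⟨IsFreeGroup.lift fun _ => Multiplicative.ofAdd 1, ?_⟩
  by_contra! h
  have h1 : IsFreeGroup.lift (fun _ : IsFreeGroup.Generators G => Multiplicative.ofAdd (1 : ℤ)) = 1 :=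
    MonoidHom.eq_of_eqOn_dense hS fun s hs => h s hs
  have h2 := IsFreeGroup.lift_of (fun _ : IsFreeGroup.Generators G => Multiplicative.ofAdd (1 : ℤ)) a
  rw [h1] at h2
  simp at h2
  exact absurd h2.symm (by decide)

/-- Free groups have the unique product property. -/
theorem IsFreeGroup.exists_uniqueMul {G : Type*} [Group G] [IsFreeGroup G] (k : ℕ) :
    ∀ A B : Finset G, A.card + B.card ≤ k → A.Nonempty → B.Nonempty →
      ∃ a ∈ A, ∃ b ∈ B, UniqueMul A B a b := by
  classical
  induction k with
  | zero =>
    intro A B h hA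
    have := hA.card_pos
    omega
  | succ k ih =>
    intro A B hk hA hB
    by_cases hc : A.card ≤ 1 ∧ B.card ≤ 1
    · exact UniqueMul.of_card_le_one hA hB hc.1 hc.2
    obtain ⟨a, ha⟩ := hA
    obtain ⟨b, hb⟩ := hB
    -- After translation so that both sets contain `1`, they generate a subgroup `H`, which is free
    -- by Nielsen–Schreier and so maps to `ℤ` nontrivially on `S`.
    let S : Set G := (fun α => a⁻¹ * α) '' A ∪ (fun β => β * b⁻¹) '' B
    let H := Subgroup.closure S
    have hSA : ∀ α ∈ A, a⁻¹ * α ∈ H := fun α h =>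
      Subgroup.subset_closure (Or.inl ⟨α, h, rfl⟩)
    have hSB : ∀ β ∈ B, β * b⁻¹ ∈ H := fun β h =>
      Subgroup.subset_closure (Or.inr ⟨β, h, rfl⟩)
    obtain ⟨g, hg⟩ : ∃ g : H, g ≠ 1 := by
      rcases not_and_or.1 hc with h | h
      · obtain ⟨α, hα, hne⟩ := Finset.exists_mem_ne (not_le.1 h) a
        exact ⟨⟨_, hSA α hα⟩, fun h => hne (inv_mul_eq_one.1 (congrArg Subtype.val h)).symm⟩
      · obtain ⟨β, hβ, hne⟩ := Finset.exists_mem_ne (not_le.1 h) b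
        exact ⟨⟨_, hSB β hβ⟩, fun h => hne (mul_inv_eq_one.1 (congrArg Subtype.val h))⟩
    obtain ⟨φ, s, hs, hφ⟩ := IsFreeGroup.exists_hom_int_ne_one
      (Subgroup.closure_closure_coe_preimage (k := S)) hg
    -- The default `0` is never taken on `A`, nor on `B` for `e`. The sum `f α + e β` depends only
    -- on `α * β`, so a product of two maximizers can only arise from maximizers.
    let f : G → ℤ := fun α => if h : a⁻¹ * α ∈ H then (φ ⟨_, h⟩).toAdd else 0
    let e : G → ℤ := fun β => if h : β * b⁻¹ ∈ H then (φ ⟨_, h⟩).toAdd else 0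
    have hadd : ∀ α ∈ A, ∀ β ∈ B, ∀ h : a⁻¹ * (α * β) * b⁻¹ ∈ H,
        f α + e β = (φ ⟨_, h⟩).toAdd := by
      intro α hα β hβ h
      simp only [f, e, dif_pos (hSA α hα), dif_pos (hSB β hβ), ← toAdd_mul, ← map_mul]
      congr 2
      ext
      simp [mul_assoc]
    obtain ⟨a₁, ha₁, hmaxA⟩ := A.exists_max_image f ⟨a, ha⟩
    obtain ⟨b₁, hb₁, hmaxB⟩ := B.exists_max_image e ⟨b, hb⟩
    -- If no element were dropped, `f` and `e` would be constant, equal to `f a = e b = 0`, and `φ`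
    -- would vanish on `S`.
    have hlt : (A.filter (f · = f a₁)).card + (B.filter (e · = e b₁)).card < A.card + B.card := by
      by_contra hge
      have h1 := A.card_filter_le (f · = f a₁)
      have h2 := B.card_filter_le (e · = e b₁)
      have hA' := Finset.filter_eq_self.1 (Finset.eq_of_subset_of_card_le
        (A.filter_subset (f · = f a₁)) (by omega))
      have hB' := Finset.filter_eq_self.1 (Finset.eq_of_subset_of_card_le
        (B.filter_subset (e · = e b₁)) (by omega))
      have hfa : f a = 0 := by
        have : (⟨a⁻¹ * a, hSA a ha⟩ : H) = 1 := by ext; simp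
        simp only [f, dif_pos (hSA a ha), this, map_one, toAdd_one]
      have heb : e b = 0 := by
        have : (⟨b * b⁻¹, hSB b hb⟩ : H) = 1 := by ext; simp
        simp only [e, dif_pos (hSB b hb), this, map_one, toAdd_one]
      obtain ⟨s, hsH⟩ := s
      rcases hs with ⟨α, hα, hs⟩ | ⟨β, hβ, hs⟩
      · simp only at hs
        subst hs
        have := hA' (x := α) hα
        rw [← hA' (x := a) ha, hfa] at this
        exact hφ (toAdd_eq_zero.1 ((dif_pos hsH).symm.trans this))
      · simp only at hs
        subst hs
        have := hB' (x := β) hβ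
        rw [← hB' (x := b) hb, heb] at this
        exact hφ (toAdd_eq_zero.1 ((dif_pos hsH).symm.trans this))
    obtain ⟨a₂, ha₂, b₂, hb₂, hu⟩ := ih (A.filter (f · = f a₁)) (B.filter (e · = e b₁)) (by omega)
      ⟨a₁, by simp [ha₁]⟩ ⟨b₁, by simp [hb₁]⟩
    rw [Finset.mem_filter] at ha₂ hb₂
    refine ⟨a₂, ha₂.1, b₂, hb₂.1, fun α β hα hβ hαβ => ?_⟩
    have hmem : a⁻¹ * (a₂ * b₂) * b⁻¹ ∈ H := by
      simpa [mul_assoc] using mul_mem (hSA a₂ ha₂.1) (hSB b₂ hb₂.1)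
    have h1 := hadd a₂ ha₂.1 b₂ hb₂.1 hmem
    have h2 := hadd α hα β hβ (hαβ ▸ hmem)
    simp only [hαβ] at h2
    have h3 := hmaxA α hα
    have h4 := hmaxB β hβ
    have h5 := ha₂.2
    have h6 := hb₂.2
    exact hu (Finset.mem_filter.2 ⟨hα, by omega⟩) (Finset.mem_filter.2 ⟨hβ, by omega⟩) hαβ

/-- Free groups have the two unique products property. -/
theorem IsFreeGroup.twoUniqueProds (G : Type*) [Group G] [IsFreeGroup G] : TwoUniqueProds G :=
  have : UniqueProds G := ⟨fun hA hB => exists_uniqueMul _ _ _ le_rfl hA hB⟩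
  UniqueProds.toTwoUniqueProds_of_group

/-! ### Trivial units in group rings over domains -/

/-- Group rings over domains of groups with the two unique products property have only trivial
units. -/
theorem MonoidAlgebra.exists_eq_single_of_isUnit {R G : Type*} [Semiring R] [NoZeroDivisors R]
    [Nontrivial R] [Group G] [TwoUniqueProds G] {u : MonoidAlgebra R G} (hu : IsUnit u) :
    ∃ g r, u = single g r := by
  classical
  obtain ⟨⟨u, v, huv, -⟩, rfl⟩ := hu
  dsimp only
  have hu0 : u.coeff.support.Nonempty := by
    rw [Finsupp.support_nonempty_iff, Ne, coeff_eq_zero]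
    rintro rfl
    simp at huv
  have hv0 : v.coeff.support.Nonempty := by
    rw [Finsupp.support_nonempty_iff, Ne, coeff_eq_zero]
    rintro rfl
    simp at huv
  -- A unique product has nonzero coefficient in `u * v = 1`, so it equals `1`; two different pairs
  -- cannot both do this.
  have hone : ∀ q ∈ u.coeff.support ×ˢ v.coeff.support,
      UniqueMul u.coeff.support v.coeff.support q.1 q.2 → q.1 * q.2 = 1 := by
    intro q hq h
    rw [Finset.mem_product, Finsupp.mem_support_iff, Finsupp.mem_support_iff] at hq
    have := coeff_mul_mul_of_uniqueMul h
    rw [huv, one_def, coeff_single, Finsupp.single_apply] at this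
    by_contra hne
    rw [if_neg (Ne.symm hne)] at this
    exact mul_ne_zero hq.1 hq.2 this.symm
  have hcard : ¬ 1 < u.coeff.support.card * v.coeff.support.card := by
    intro h
    obtain ⟨q₁, h₁, q₂, h₂, hne, hu₁, hu₂⟩ := TwoUniqueProds.uniqueMul_of_one_lt_card h
    rw [Finset.mem_product] at h₂
    have := hu₁ h₂.1 h₂.2 ((hone q₂ (Finset.mem_product.2 h₂) hu₂).trans (hone q₁ h₁ hu₁).symm)
    exact hne (Prod.ext this.1.symm this.2.symm)
  have hu1 : u.coeff.support.card = 1 := by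
    have h1 := hu0.card_pos
    have h2 := hv0.card_pos
    nlinarith
  obtain ⟨g, r, h⟩ := Finsupp.card_support_eq_one'.1 hu1
  exact ⟨g, r, coeff_injective h.2⟩

/-! ### A conjugacy invariant from `SL₂(ℤ)` -/

/-- The trace in `SL₂(ℤ)` separates the elements `t sⁿ t s⁻ⁿ` for elementary matrices `s`, `t`. -/
theorem FreeGroup.eq_of_isConj_mul_conj {ι : Type*} {i j : ι} (hij : i ≠ j) {n k : ℕ}
    (h : IsConj (of j * (of i ^ n * of j * (of i ^ n)⁻¹))
      (of j * (of i ^ k * of j * (of i ^ k)⁻¹))) : n = k := by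
  classical
  let S : Matrix.SpecialLinearGroup (Fin 2) ℤ := ⟨!![1, 0; 1, 1], by simp⟩
  let T : Matrix.SpecialLinearGroup (Fin 2) ℤ := ⟨!![1, 1; 0, 1], by simp⟩
  have hS : ∀ n : ℕ, (↑(S ^ n) : Matrix (Fin 2) (Fin 2) ℤ) = !![1, 0; (n : ℤ), 1] := by
    intro n
    induction n with
    | zero => simp [Matrix.one_fin_two]
    | succ n ih =>
      rw [pow_succ, Matrix.SpecialLinearGroup.coe_mul, ih]
      simp [S]
  have hT : (↑T : Matrix (Fin 2) (Fin 2) ℤ) = !![1, 1; 0, 1] := rfl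
  let φ := FreeGroup.lift fun l : ι => if l = i then S else if l = j then T else 1
  have hi : φ (of i) = S := by simp [φ]
  have hj : φ (of j) = T := by simp [φ, hij.symm]
  have htr : ∀ n : ℕ, Matrix.trace
      (φ (of j * (of i ^ n * of j * (of i ^ n)⁻¹)) : Matrix (Fin 2) (Fin 2) ℤ) = 2 - (n : ℤ) ^ 2 := by
    intro n
    simp only [_root_.map_mul, _root_.map_inv, _root_.map_pow, hi, hj]
    simp only [Matrix.SpecialLinearGroup.coe_mul, Matrix.SpecialLinearGroup.coe_inv, hS, hT]
    simp [Matrix.adjugate_fin_two, Matrix.trace_fin_two]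
    ring
  obtain ⟨c, hc⟩ := isConj_iff.1 h
  have h1 := htr k
  rw [← hc, _root_.map_mul, _root_.map_mul, _root_.map_inv, Matrix.SpecialLinearGroup.coe_mul,
    Matrix.trace_mul_comm, ← Matrix.SpecialLinearGroup.coe_mul, inv_mul_cancel_left, htr n] at h1
  have : (n : ℤ) ^ 2 = (k : ℤ) ^ 2 := by linarith
  exact_mod_cast (pow_left_inj₀ (Int.natCast_nonneg n) (Int.natCast_nonneg k) two_ne_zero).1 this

/-! ### Monomial factors over the dual numbers -/

noncomputable section

/-- The ring homomorphism `R[C × G] → R[C][G]` with `(c, g) ↦ c g`. -/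
def MonoidAlgebra.swapCurryRingHom (R C G : Type*) [Semiring R] [Monoid C] [Monoid G] :
    MonoidAlgebra R (C × G) →+* MonoidAlgebra (MonoidAlgebra R C) G :=
  (curryRingEquiv (R := R) (M := G) (N := C)).toRingHom.comp
    (mapDomainRingHom R (MulEquiv.prodComm : C × G ≃* G × C))

@[simp]
theorem MonoidAlgebra.swapCurryRingHom_single {R C G : Type*} [Semiring R] [Monoid C] [Monoid G]
    (c : C) (g : G) (r : R) :
    swapCurryRingHom R C G (single (c, g) r) = single g (single c r) := by
  simp [swapCurryRingHom]

/-- If `1 + (a - b) α ε` and `1 + (c - d) α ε` in `k[ε][G]` differ by monomial factors on the left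
and on the right, then `a b` and `c d` are conjugate, unless both differences `a - b` and `c - d` vanish. -/
theorem MonoidAlgebra.isConj_of_dualNumber_eq {k G : Type*} [CommRing k] [Nontrivial k] [Group G]
    {α : k} (hα : α ≠ 0) {a b c d g h : G} {r₁ r₂ : DualNumber k} (ha : a ≠ 1) (hb : b ≠ 1)
    (hc : c ≠ 1) (hd : d ≠ 1)
    (H : (1 + single a (TrivSqZeroExt.inr α) - single b (TrivSqZeroExt.inr α) :
        MonoidAlgebra (DualNumber k) G) =
      single g r₁ * (1 + single c (TrivSqZeroExt.inr α) - single d (TrivSqZeroExt.inr α)) *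
        single h r₂) : IsConj (a * b) (c * d) ∨ a = b ∧ c = d := by
  classical
  have h1 := congrArg (mapRingHom G (TrivSqZeroExt.fstHom k k k).toRingHom) H
  simp only [map_mul, map_add, map_sub, map_one, mapRingHom_single, AlgHom.toRingHom_eq_coe,
    RingHom.coe_coe, TrivSqZeroExt.fstHom_apply, TrivSqZeroExt.fst_inr, single_zero, add_zero,
    sub_zero, mul_one, single_mul_single, one_def] at h1
  have h2 := (Finsupp.single_eq_single_iff _ _ _ _).1 (congrArg coeff h1)
  obtain ⟨h3, h4⟩ : 1 = g * h ∧ 1 = r₁.fst * r₂.fst := by simpa using h2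
  obtain rfl : h = g⁻¹ := (inv_eq_of_mul_eq_one_right h3.symm).symm
  have hr : r₁ * TrivSqZeroExt.inr α * r₂ = TrivSqZeroExt.inr α := by
    rw [mul_right_comm]
    ext
    · simp
    · simp [← h4]
  simp only [mul_add, mul_sub, add_mul, sub_mul, one_def, single_mul_single, mul_one, hr,
    mul_inv_cancel] at H
  -- Compare `ε`-parts. The coefficient at `1` is excluded, since `r₁ * r₂` may have an `ε`-part
  -- there.
  have key : ∀ q ≠ 1, ((if a = q then α else 0) - if b = q then α else 0) =
      (if g * c * g⁻¹ = q then α else 0) - if g * d * g⁻¹ = q then α else 0 := by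
    intro q hq
    have := congrArg (fun f => (coeff f q).snd) H
    simp only [coeff_add, coeff_sub, coeff_single, Finsupp.add_apply, Finsupp.sub_apply,
      Finsupp.single_apply, if_neg hq.symm, zero_add, TrivSqZeroExt.snd_sub] at this
    simpa only [apply_ite TrivSqZeroExt.snd, TrivSqZeroExt.snd_inr, TrivSqZeroExt.snd_zero]
      using this
  have hc' : g * c * g⁻¹ ≠ 1 := by simpa using hc
  have hd' : g * d * g⁻¹ ≠ 1 := by simpa using hd
  -- In characteristic 2 the sign is lost and the pair may be swapped; the conjugacy class of the
  -- product does not see the order.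
  have key' : a * b = (g * c * g⁻¹) * (g * d * g⁻¹) ∨ a * b = (g * d * g⁻¹) * (g * c * g⁻¹) ∨
      (a = b ∧ c = d) := by
    have k1 := key a ha
    have k2 := key b hb
    have k3 := key _ hc'
    have k4 := key _ hd'
    have : g * c * g⁻¹ = g * d * g⁻¹ ↔ c = d := by simp
    rw [← this]
    generalize g * c * g⁻¹ = c' at *
    generalize g * d * g⁻¹ = d' at *
    grind
  rcases key' with h | h | h
  · exact Or.inl (isConj_iff.2 ⟨g, by rw [h]; group⟩).symm
  · exact Or.inl (isConj_iff.2 ⟨g * d, by rw [h]; group⟩).symm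
  · exact Or.inr h

/-! ### Units of `ℤ[C_p × G]` -/

namespace UnitCosets
open Polynomial

instance isDomain_adjoinRoot_cyclotomic (n : ℕ) [NeZero n] :
    IsDomain (AdjoinRoot (cyclotomic n ℤ)) :=
  AdjoinRoot.isDomain_of_prime (cyclotomic.irreducible (NeZero.pos n)).prime

theorem root_cyclotomic_pow (p : ℕ) : AdjoinRoot.root (cyclotomic p ℤ) ^ p = 1 := by
  rw [← sub_eq_zero, ← AdjoinRoot.mk_X, ← map_pow, ← map_one (AdjoinRoot.mk _), ← map_sub,
    AdjoinRoot.mk_eq_zero]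
  exact cyclotomic.dvd_X_pow_sub_one p ℤ

variable (p : ℕ) [hp : Fact p.Prime]

/-- The ring homomorphism `ℤ[C_p] → ℤ[ζ_p]`. -/
def cycToZeta : MonoidAlgebra ℤ (Cyc p) →+* AdjoinRoot (cyclotomic p ℤ) :=
  (MonoidAlgebra.lift ℤ _ (Cyc p) (AddChar.zmodChar p (root_cyclotomic_pow p)).toMonoidHom).toRingHom

/-- The augmentation `ℤ[C_p] → ℤ`. -/
def augmentation : MonoidAlgebra ℤ (Cyc p) →+* ℤ :=
  (MonoidAlgebra.lift ℤ ℤ (Cyc p) 1).toRingHom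

theorem exists_aeval_eq (r : MonoidAlgebra ℤ (Cyc p)) :
    ∃ P : ℤ[X], aeval (MonoidAlgebra.of ℤ (Cyc p) (Multiplicative.ofAdd 1)) P = r := by
  induction r using MonoidAlgebra.induction_linear with
  | zero => exact ⟨0, map_zero _⟩
  | add a b ha hb =>
    obtain ⟨P, rfl⟩ := ha
    obtain ⟨Q, rfl⟩ := hb
    exact ⟨P + Q, map_add _ _ _⟩
  | single c r =>
    refine ⟨monomial c.toAdd.val r, ?_⟩
    rw [aeval_monomial, ← map_pow, ← ofAdd_nsmul]
    simp [MonoidAlgebra.of_apply, ← zsmul_eq_mul]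

theorem cycToZeta_aeval (P : ℤ[X]) :
    cycToZeta p (aeval (MonoidAlgebra.of ℤ (Cyc p) (Multiplicative.ofAdd 1)) P) =
      AdjoinRoot.mk _ P := by
  rw [← AdjoinRoot.aeval_eq]
  have : cycToZeta p (MonoidAlgebra.of ℤ (Cyc p) (Multiplicative.ofAdd 1)) =
      AdjoinRoot.root (cyclotomic p ℤ) := by
    have := AddChar.zmodChar_apply' (root_cyclotomic_pow p) 1
    simpa [cycToZeta] using this
  rw [← this]
  exact (aeval_algHom_apply (cycToZeta p).toIntAlgHom _ P).symm

theorem augmentation_aeval (P : ℤ[X]) :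
    augmentation p (aeval (MonoidAlgebra.of ℤ (Cyc p) (Multiplicative.ofAdd 1)) P) = P.eval 1 := by
  have : augmentation p (MonoidAlgebra.of ℤ (Cyc p) (Multiplicative.ofAdd 1)) = 1 := by
    simp [augmentation]
  rw [← coe_aeval_eq_eval, ← this]
  exact (aeval_algHom_apply (augmentation p).toIntAlgHom _ P).symm

/-- The kernel of `cycToZeta` is generated by the value of `Φ_p` at the generator, and `Φ_p(1) = p`.
-/
theorem dvd_augmentation_of_cycToZeta_eq_zero {r : MonoidAlgebra ℤ (Cyc p)}
    (h : cycToZeta p r = 0) : (p : ℤ) ∣ augmentation p r := by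
  obtain ⟨P, rfl⟩ := exists_aeval_eq p r
  rw [cycToZeta_aeval, AdjoinRoot.mk_eq_zero] at h
  obtain ⟨Q, rfl⟩ := h
  rw [augmentation_aeval, eval_mul, eval_one_cyclotomic_prime]
  exact dvd_mul_right _ _

/-- A polynomial divisible by `Φ_p` and vanishing at `1` is divisible by `Φ_p (X - 1) = X^p - 1`. -/
theorem eq_zero_of_cycToZeta_eq_zero {r : MonoidAlgebra ℤ (Cyc p)}
    (h : cycToZeta p r = 0) (h' : augmentation p r = 0) : r = 0 := by
  obtain ⟨P, rfl⟩ := exists_aeval_eq p r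
  rw [cycToZeta_aeval, AdjoinRoot.mk_eq_zero] at h
  obtain ⟨Q, rfl⟩ := h
  rw [augmentation_aeval, eval_mul, eval_one_cyclotomic_prime, mul_eq_zero] at h'
  have hQ : Q.eval 1 = 0 := h'.resolve_left (by exact_mod_cast hp.out.ne_zero)
  obtain ⟨S, rfl⟩ := dvd_iff_isRoot.2 hQ
  rw [← mul_assoc, C_1, cyclotomic_prime_mul_X_sub_one, map_mul, map_sub, map_pow, aeval_X,
    ← map_pow, cyc_pow, map_one, map_one, sub_self, zero_mul]

/-- The units of `ℤ[C_p × G]` are the products of units of `ℤ[C_p]` and elements of `G`. -/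
theorem exists_swapCurryRingHom_eq_single {G : Type*} [Group G] [TwoUniqueProds G]
    {v : MonoidAlgebra ℤ (Cyc p × G)} (hv : IsUnit v) :
    ∃ h r, MonoidAlgebra.swapCurryRingHom ℤ (Cyc p) G v = MonoidAlgebra.single h r := by
  have hw := hv.map (MonoidAlgebra.swapCurryRingHom ℤ (Cyc p) G)
  generalize MonoidAlgebra.swapCurryRingHom ℤ (Cyc p) G v = w at hw
  have : NeZero p := ⟨hp.out.ne_zero⟩
  obtain ⟨h, r, hr⟩ := MonoidAlgebra.exists_eq_single_of_isUnit
    (hw.map (MonoidAlgebra.mapRingHom G (cycToZeta p)))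
  have hw' := hw.map (MonoidAlgebra.mapRingHom G (augmentation p))
  obtain ⟨g, c, hc⟩ := MonoidAlgebra.exists_eq_single_of_isUnit hw'
  have hcp : ¬ (p : ℤ) ∣ c := by
    have := (hw'.map (MonoidAlgebra.mapRingHom G (Int.castRingHom (ZMod p)))).ne_zero
    rw [hc, MonoidAlgebra.mapRingHom_single] at this
    intro hdvd
    exact this (by rw [eq_intCast, (ZMod.intCast_zmod_eq_zero_iff_dvd _ _).2 hdvd,
      MonoidAlgebra.single_zero])
  have h1 : ∀ q ≠ h, cycToZeta p (w.coeff q) = 0 := by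
    intro q hq
    rw [← MonoidAlgebra.coeff_mapRingHom, hr, MonoidAlgebra.coeff_single,
      Finsupp.single_eq_of_ne hq]
  have h2 : ∀ q ≠ g, augmentation p (w.coeff q) = 0 := by
    intro q hq
    rw [← MonoidAlgebra.coeff_mapRingHom, hc, MonoidAlgebra.coeff_single,
      Finsupp.single_eq_of_ne hq]
  -- Otherwise the coefficient of `w` at `g` would die in `ℤ[ζ_p]`, forcing `p ∣ c`.
  obtain rfl : g = h := by
    by_contra hne
    have := dvd_augmentation_of_cycToZeta_eq_zero p (h1 g hne)
    rw [← MonoidAlgebra.coeff_mapRingHom, hc, MonoidAlgebra.coeff_single,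
      Finsupp.single_eq_same] at this
    exact hcp this
  refine ⟨g, w.coeff g, MonoidAlgebra.ext (Finsupp.ext fun q => ?_)⟩
  rw [MonoidAlgebra.coeff_single]
  by_cases hq : q = g
  · rw [hq, Finsupp.single_eq_same]
  · rw [Finsupp.single_eq_of_ne hq, eq_zero_of_cycToZeta_eq_zero p (h1 q hq) (h2 q hq)]

/-! ### Passage to `𝔽_p[ε][F_m]` and separation of the double cosets -/

/-- The ring homomorphism `𝔽_p[C_p] → 𝔽_p[ε]` with `c ↦ 1 + c ε`. -/
def cycToDual : MonoidAlgebra (ZMod p) (Cyc p) →+* DualNumber (ZMod p) :=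
  (MonoidAlgebra.lift (ZMod p) (DualNumber (ZMod p)) (Cyc p)
    { toFun c := 1 + TrivSqZeroExt.inr c.toAdd
      map_one' := by simp
      map_mul' c d := by
        ext
        · simp
        · simp [add_comm] }).toRingHom

theorem cycToDual_yElem (x : Cyc p) : cycToDual p (yElem p x) = TrivSqZeroExt.inr (-x.toAdd) := by
  simp [cycToDual, yElem]

variable (m : ℕ)

/-- The ring homomorphism `𝔽_p[C_p × F_m] → 𝔽_p[ε][F_m]` induced by `c ↦ 1 + c ε`. -/
def toDual : RingZero p m →+* MonoidAlgebra (DualNumber (ZMod p)) (Free m) :=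
  (MonoidAlgebra.mapRingHom (Free m) (cycToDual p)).comp
    (MonoidAlgebra.swapCurryRingHom (ZMod p) (Cyc p) (Free m))

theorem toDual_incl (a : MonoidAlgebra (ZMod p) (Cyc p)) (g : Free m) :
    toDual p m (inclCyc p m a * inclFree p m g) = MonoidAlgebra.single g (cycToDual p a) := by
  induction a using MonoidAlgebra.induction_linear with
  | zero => simp
  | add a b ha hb => rw [map_add, add_mul, map_add, ha, hb, map_add, MonoidAlgebra.single_add]
  | single c r => simp [inclCyc, inclFree, toDual, MonoidAlgebra.single_mul_single]

theorem toDual_inclFree (g : Free m) :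
    toDual p m (inclFree p m g) = MonoidAlgebra.single g 1 := by
  simpa using toDual_incl p m 1 g

theorem toDual_psiMinus (x : Cyc p) (u : RingMinus p m) : toDual p m (psiMinus p m x u) =
    MonoidAlgebra.mapRingHom (Free m) ((cycToDual p).comp (zetaHom p x)) u := by
  induction u using MonoidAlgebra.induction_linear with
  | zero => simp
  | add a b ha hb => simp only [map_add, ha, hb]
  | single g r =>
    rw [psiMinus, MonoidAlgebra.liftNCRingHom_single, RingHom.comp_apply, toDual_incl,
      MonoidAlgebra.mapRingHom_single, RingHom.comp_apply]

theorem toDual_psiPlus (v : RingPlus p m) : toDual p m (psiPlus p m v) =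
    MonoidAlgebra.mapRingHom (Free m)
      ((cycToDual p).comp (MonoidAlgebra.mapRingHom (Cyc p) (Int.castRingHom (ZMod p))))
      (MonoidAlgebra.swapCurryRingHom ℤ (Cyc p) (Free m) v) := by
  induction v using MonoidAlgebra.induction_linear with
  | zero => simp
  | add a b ha hb => simp only [map_add, ha, hb]
  | single g r =>
    obtain ⟨c, g⟩ := g
    simp only [psiPlus, toDual, RingHom.comp_apply, MonoidAlgebra.mapRingHom_single,
      MonoidAlgebra.swapCurryRingHom_single]

theorem exists_toDual_eq_single_of_mem_unitsMinus (x : Cyc p) {u : (RingZero p m)ˣ}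
    (hu : u ∈ unitsMinus p m x) : ∃ g r, toDual p m u = MonoidAlgebra.single g r := by
  obtain ⟨u, rfl⟩ := hu
  have : NeZero p := ⟨hp.out.ne_zero⟩
  have : TwoUniqueProds (Free m) := IsFreeGroup.twoUniqueProds _
  obtain ⟨g, r, h⟩ := MonoidAlgebra.exists_eq_single_of_isUnit u.isUnit
  have := toDual_psiMinus p m x u
  rw [h, MonoidAlgebra.mapRingHom_single, ← h] at this
  exact ⟨g, _, this⟩

theorem exists_toDual_eq_single_of_mem_unitsPlus {v : (RingZero p m)ˣ}
    (hv : v ∈ unitsPlus p m) : ∃ g r, toDual p m v = MonoidAlgebra.single g r := by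
  obtain ⟨v, rfl⟩ := hv
  have : TwoUniqueProds (Free m) := IsFreeGroup.twoUniqueProds _
  obtain ⟨g, r, h⟩ := exists_swapCurryRingHom_eq_single p v.isUnit
  have := toDual_psiPlus p m v
  rw [h, MonoidAlgebra.mapRingHom_single] at this
  exact ⟨g, _, this⟩

theorem toDual_delta (x : Cyc p) (s t : Free m) (n : ℕ) : toDual p m (delta p m x s t n) =
    1 + MonoidAlgebra.single t (TrivSqZeroExt.inr (-x.toAdd)) -
      MonoidAlgebra.single (s ^ n * t * (s ^ n)⁻¹) (TrivSqZeroExt.inr (-x.toAdd)) := by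
  have h1 : toDual p m (oneAddYT p m x t) =
      1 + MonoidAlgebra.single t (TrivSqZeroExt.inr (-x.toAdd)) := by
    rw [oneAddYT, IsUnit.unit_spec, map_add, map_one, toDual_incl, cycToDual_yElem]
  -- Since `ε² = 0`, the geometric series for the inverse stops after the linear term.
  have h2 : toDual p m ↑(oneAddYT p m x t)⁻¹ =
      1 - MonoidAlgebra.single t (TrivSqZeroExt.inr (-x.toAdd)) := by
    refine (left_inv_eq_right_inv (a := toDual p m (oneAddYT p m x t)) ?_ ?_)
    · rw [← map_mul, Units.inv_mul, map_one]
    · rw [h1]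
      simp only [mul_sub, add_mul, one_mul, mul_one, MonoidAlgebra.single_mul_single,
        TrivSqZeroExt.inr_mul_inr, MonoidAlgebra.single_zero, add_zero, add_sub_cancel_right]
  have h3 : ∀ g : Free m, toDual p m (freeUnit p m g) = MonoidAlgebra.single g 1 :=
    toDual_inclFree p m
  rw [delta, ← map_pow, ← map_inv]
  simp only [Units.val_mul, map_mul, h1, h2, h3]
  simp only [mul_sub, add_mul, sub_mul, one_mul, mul_one, MonoidAlgebra.single_mul_single,
    TrivSqZeroExt.inr_mul_inr, MonoidAlgebra.single_zero]
  simp only [mul_inv_cancel, mul_inv_cancel_right, MonoidAlgebra.one_def, add_sub_assoc,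
    zero_mul, add_zero]

theorem cosetClass_delta_injective {x : Cyc p} (hx : x ≠ 1) {i j : Fin m} (hij : i ≠ j) :
    Function.Injective fun n : ℕ =>
      cosetClass p m x (delta p m x (FreeGroup.of i) (FreeGroup.of j) n) := by
  intro n k hnk
  obtain ⟨u, hu, v, hv, huv⟩ := (DoubleCoset.eq _ _ _ _).1 hnk
  obtain ⟨g, r, hg⟩ := exists_toDual_eq_single_of_mem_unitsMinus p m x hu
  obtain ⟨h, r', hh⟩ := exists_toDual_eq_single_of_mem_unitsPlus p m hv
  have key := congrArg (fun w : (RingZero p m)ˣ => toDual p m w) huv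
  simp only [Units.val_mul, map_mul, hg, hh, toDual_delta] at key
  have hj : (FreeGroup.of j : Free m) ≠ 1 := FreeGroup.of_ne_one j
  have hconj : ∀ c : Free m, c * FreeGroup.of j * c⁻¹ ≠ 1 := fun c => by simp
  refine (FreeGroup.eq_of_isConj_mul_conj hij ?_).symm
  rcases MonoidAlgebra.isConj_of_dualNumber_eq (by simpa using hx) hj (hconj _) hj (hconj _) key
    with hc | ⟨h1, h2⟩
  · exact hc
  -- Here both conjugates of `t` equal `t`, so the two products coincide; this covers `δ_0 = 1`.
  · rw [← h1, ← h2]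

theorem delta_mem_commutator (x : Cyc p) (s t : Free m) (n : ℕ) :
    delta p m x s t n ∈ commutator (RingZero p m)ˣ :=
  Subgroup.commutator_mem_commutator (Subgroup.mem_top _) (Subgroup.mem_top _)

end UnitCosets

end

theorem proposition4p2 (p m : ℕ) [Fact p.Prime] (hm : 2 ≤ m)
    (x : UnitCosets.Cyc p) (hx : Subgroup.zpowers x = ⊤) :
    (UnitCosets.commutatorCosets p m x).Infinite ∧
    ∀ i j : Fin m, i ≠ j →
      (∀ n : ℕ, UnitCosets.delta p m x (FreeGroup.of i) (FreeGroup.of j) n ∈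
        commutator (UnitCosets.RingZero p m)ˣ) ∧
      Function.Injective fun n : ℕ =>
        UnitCosets.cosetClass p m x
          (UnitCosets.delta p m x (FreeGroup.of i) (FreeGroup.of j) n) := by
  have hx1 : x ≠ 1 := by
    rintro rfl
    rw [Subgroup.zpowers_one_eq_bot] at hx
    exact bot_ne_top hx
  have key : ∀ i j : Fin m, i ≠ j → _ := fun i j hij =>
    UnitCosets.cosetClass_delta_injective p m hx1 hij
  refine ⟨?_, fun i j hij => ⟨UnitCosets.delta_mem_commutator p m x _ _, key i j hij⟩⟩
  refine Set.infinite_of_injective_forall_mem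
    (key ⟨0, by omega⟩ ⟨1, by omega⟩ (by simp)) fun n =>
      ⟨_, UnitCosets.delta_mem_commutator p m x _ _ n, rfl⟩
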